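/- Let $n\ge 2$ and let $\mathcal M_n\cong\mathbb C^{n^2}$ be the space of complex $n\times n$ matrices. Let $\rho(A)$ denote the spectral radius of $A\in\mathcal M_n$ and let $\Omega_n=\{A\in\mathcal M_n:\rho(A)<1\}$ be the spectral unit ball. For $A\in\mathcal M_n$ define $\sigma(A)=(\sigma_1(A),\dots,\sigma_n(A))\in\mathbb C^n$ by $\det(\lambda I-A)=\lambda^n+\sum_{j=1}^n(-1)^j\sigma_j(A)\lambda^{n-j}$, and let $\mathbb G_n=\sigma(\Omega_n)$ be the symmetrized polydisc. Then for every $z\in\mathbb G_n$ the fibre $\mathcal T_z=\{A\in\Omega_n:\sigma(A)=z\}$ is an irreducible analytic subset of $\Omega_n$ of codimension $n$. That is: every point of $\Omega_n$ has an open neighbourhood in $\Omega_n$ in which $\mathcal T_z$ is the common zero set of finitely many holomorphic functions; $\mathcal T_z$ is nonempty and is not the union of two analytic subsets of $\Omega_n$ both different from $\mathcal T_z$; and at each $A\in\mathcal T_z$ the dimension of $\mathcal T_z$, i.e. the upper limit of the dimensions of $\mathcal T_z$ at its regular points (the points near which it is a complex submanifold) tending to $A$, equals $n^2-n$. -/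

import Mathlib

/- The matrix space carries the operator norm subordinate to the sup norm; all norms on it are
equivalent, and the notions below do not depend on the choice. -/
open scoped Matrix.Norms.Operator

namespace SpectralBall

section AnalyticSets

variable {E : Type*} [NormedAddCommGroup E] [NormedSpace ℂ E]

/-- `A` is an analytic subset of the open set `Ω`: every point of `Ω` (not only of `A`) has an open
neighbourhood in `Ω` in which `A` is the common zero set of finitely many holomorphic functions. -/
def IsAnalyticSubset (Ω A : Set E) : Prop :=
  A ⊆ Ω ∧ ∀ a ∈ Ω, ∃ U : Set E, IsOpen U ∧ a ∈ U ∧ U ⊆ Ω ∧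
    ∃ (N : ℕ) (f : Fin N → E → ℂ), (∀ i, AnalyticOnNhd ℂ (f i) U) ∧
      A ∩ U = {x | x ∈ U ∧ ∀ i, f i x = 0}

/-- `A` is an irreducible analytic subset of `Ω`: it is analytic in `Ω`, nonempty, and not the union
of two analytic subsets of `Ω` that are both different from `A`. -/
def IsIrreducibleAnalyticSubset (Ω A : Set E) : Prop :=
  IsAnalyticSubset Ω A ∧ A.Nonempty ∧
    ∀ A₁ A₂ : Set E, IsAnalyticSubset Ω A₁ → IsAnalyticSubset Ω A₂ → A = A₁ ∪ A₂ →
      A₁ = A ∨ A₂ = A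

/-- `a` is a regular point of `A` of dimension `d`: near `a` the set `A` is a complex submanifold of
dimension `d`, i.e. some biholomorphic map between open sets, defined near `a`, carries `A` to a
piece of a linear subspace of dimension `d`. -/
def IsRegularPoint (A : Set E) (d : ℕ) (a : E) : Prop :=
  a ∈ A ∧ ∃ (e : OpenPartialHomeomorph E E) (L : Submodule ℂ E),
    a ∈ e.source ∧ AnalyticOnNhd ℂ e e.source ∧ AnalyticOnNhd ℂ e.symm e.target ∧
      Module.finrank ℂ L = d ∧ A ∩ e.source = {x | x ∈ e.source ∧ e x ∈ L}

/-- The dimension of `A` at `a`: the upper limit, as `b → a` along the regular points `b` of `A`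
(`b = a` allowed), of the dimension of `A` at `b`. It is `⊥` if `a` is not in the closure of the
set of regular points. -/
noncomputable def dimAt (A : Set E) (a : E) : WithBot ℕ∞ :=
  ⨅ U ∈ nhds a, ⨆ (b : E) (_ : b ∈ U) (d : ℕ) (_ : IsRegularPoint A d b), (d : WithBot ℕ∞)

/-- `A` has codimension `k` (at each of its points) in `E`. -/
def HasCodimension (A : Set E) (k : ℕ) : Prop :=
  ∀ a ∈ A, dimAt A a + (k : WithBot ℕ∞) = (Module.finrank ℂ E : WithBot ℕ∞)

end AnalyticSets

/-- The spectral unit ball `Ω_n`. -/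
def spectralBall (n : ℕ) : Set (Matrix (Fin n) (Fin n) ℂ) :=
  {A | spectralRadius ℂ A < 1}

/-- The map `σ = (σ_1, …, σ_n)`, where
`det (λ I - A) = λ ^ n + ∑_{j=1}^n (-1) ^ j σ_j(A) λ ^ (n - j)`; the component with index
`j : Fin n` is `σ_{j+1}`. -/
noncomputable def sigma (n : ℕ) (A : Matrix (Fin n) (Fin n) ℂ) : Fin n → ℂ :=
  fun j => (-1) ^ ((j : ℕ) + 1) * A.charpoly.coeff (n - ((j : ℕ) + 1))

/-- The symmetrized polydisc `𝔾_n = σ(Ω_n)`. -/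
def symmetrizedPolydisc (n : ℕ) : Set (Fin n → ℂ) :=
  sigma n '' spectralBall n

/-- The fibre `𝒯_z` of `σ` in `Ω_n`. -/
def fibre (n : ℕ) (z : Fin n → ℂ) : Set (Matrix (Fin n) (Fin n) ℂ) :=
  {A | A ∈ spectralBall n ∧ sigma n A = z}

end SpectralBall

/-! The conjugates g⁻¹ C g of the companion matrix C of z form a dense set of good points in the
fibre.

Density (`mem_closure_conj_companion`): conjugate a member of the fibre to an upper triangular T and
move along the line from T to diag(T) plus the superdiagonal. The characteristic polynomial is
constant on this line, and for all but finitely many parameters the row vector e₀ is cyclic, which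
makes the matrix conjugate to C.

Irreducibility (`IsAnalyticSubset.isIrreducible`): two good points are joined by conjugating C with
the pencil g₀ + t(g₁ - g₀), off the finitely many t where it is singular. By the identity theorem,
an analytic set containing a piece of this curve contains all of it.

Codimension (`isRegularPoint_conj_companion`): w ↦ g⁻¹ C(w) g is an affine section of σ, so σ is a
submersion at the good points and they are regular of dimension n² - n. -/

namespace SpectralBall

open Filter Topology

/-! ### Analytic sets, regular points and dimension -/

section AnalyticSets

variable {E : Type*} [NormedAddCommGroup E] [NormedSpace ℂ E] {Ω A : Set E}

theorem IsAnalyticSubset.mem_of_mem_closure (hA : IsAnalyticSubset Ω A) {x : E} (hx : x ∈ Ω)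
    (hxA : x ∈ closure A) : x ∈ A := by
  obtain ⟨U, hU, hxU, -, N, f, hf, hAU⟩ := hA.2 x hx
  suffices x ∈ A ∩ U from this.1
  rw [hAU]
  refine ⟨hxU, fun i => ?_⟩
  by_contra hne
  have h1 : ∀ᶠ y in 𝓝 x, f i y ≠ 0 := (hf i x hxU).continuousAt.eventually_ne hne
  obtain ⟨y, hyA, hy, hyU⟩ := ((mem_closure_iff_frequently.1 hxA).and_eventually
    (h1.and (hU.mem_nhds hxU))).exists
  have : y ∈ A ∩ U := ⟨hyA, hyU⟩
  rw [hAU] at this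
  exact hy (this.2 i)

/-- An analytic curve that runs in an analytic subset for a while stays in it. -/
theorem IsAnalyticSubset.mapsTo_of_eventually (hA : IsAnalyticSubset Ω A) {h : ℂ → E} {U : Set ℂ}
    (hU : IsPreconnected U) (hh : AnalyticOnNhd ℂ h U) (hΩ : Set.MapsTo h U Ω) {t₀ : ℂ}
    (ht₀ : t₀ ∈ U) (hev : ∀ᶠ t in 𝓝 t₀, h t ∈ A) : Set.MapsTo h U A := by
  have key : U ⊆ {t | ∀ᶠ s in 𝓝 t, h s ∈ A} := by
    refine hU.subset_of_closure_inter_subset isOpen_setOfPred_eventually_nhds ⟨t₀, ht₀, hev⟩ ?_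
    rintro t ⟨htc, htU⟩
    obtain ⟨W, hW, htW, -, N, f, hf, hAW⟩ := hA.2 (h t) (hΩ htU)
    have hWt : ∀ᶠ s in 𝓝 t, h s ∈ W := (hh t htU).continuousAt.eventually (hW.mem_nhds htW)
    have hz : ∀ i, ∀ᶠ s in 𝓝 t, f i (h s) = 0 := by
      intro i
      have han : AnalyticAt ℂ (fun s => f i (h s)) t := (hf i _ htW).comp (hh t htU)
      obtain hz | hz := han.eventually_eq_zero_or_eventually_ne_zero
      · exact hz
      · exfalso
        rw [eventually_nhdsWithin_iff] at hz
        -- Near s the curve stays in `A`, so `f i ∘ h` vanishes there; but near t it has no zero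
        -- other than t. Hence a neighbourhood of s would reduce to {t}.
        obtain ⟨s, hs, hs1, hs2⟩ := ((mem_closure_iff_frequently.1 htc).and_eventually
          (hz.eventually_nhds.and hWt.eventually_nhds)).exists
        have hs' : ∀ᶠ r in 𝓝 s, r = t := by
          filter_upwards [hs, hs1, hs2] with r hr hr1 hr2
          by_contra hne
          have : h r ∈ A ∩ W := ⟨hr, hr2⟩
          rw [hAW] at this
          exact hr1 hne (this.2 i)
        have hst : s = t := hs'.self_of_nhds
        subst hst
        have hbot : 𝓝[≠] s = ⊥ := by
          rw [← Filter.empty_mem_iff_bot]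
          filter_upwards [hs'.filter_mono nhdsWithin_le_nhds, self_mem_nhdsWithin] with r h1 h2
            using h2 h1
        exact NeBot.ne inferInstance hbot
    filter_upwards [hWt, eventually_all.2 hz] with s hs hs'
    have : h s ∈ A ∩ W := by rw [hAW]; exact ⟨hs, hs'⟩
    exact this.1
  exact fun t ht => (key ht).self_of_nhds

/-- An analytic set is irreducible if it has a dense subset any two points of which lie on an
analytic curve in the set. -/
theorem IsAnalyticSubset.isIrreducible (hA : IsAnalyticSubset Ω A) {O : Set E}
    (hOA : A ⊆ closure O) (hne : A.Nonempty)
    (hO : ∀ x ∈ O, ∀ y ∈ O, ∃ (U : Set ℂ) (h : ℂ → E), IsOpen U ∧ IsPreconnected U ∧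
      AnalyticOnNhd ℂ h U ∧ Set.MapsTo h U A ∧ x ∈ h '' U ∧ y ∈ h '' U) :
    IsIrreducibleAnalyticSubset Ω A := by
  refine ⟨hA, hne, fun A₁ A₂ h₁ h₂ hU => ?_⟩
  have aux : ∀ B ⊆ A, IsAnalyticSubset Ω B → B ≠ A → ∃ x ∈ O, x ∉ B := by
    intro B hBA hB hBne
    by_contra! hcon
    exact hBne (hBA.antisymm fun x hx =>
      hB.mem_of_mem_closure (hA.1 hx) (closure_mono hcon (hOA hx)))
  by_contra! hcon
  obtain ⟨x, hxO, hx⟩ := aux A₁ (hU ▸ Set.subset_union_left) h₁ hcon.1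
  obtain ⟨y, hyO, hy⟩ := aux A₂ (hU ▸ Set.subset_union_right) h₂ hcon.2
  obtain ⟨U, h, hUo, hUc, hh, hmaps, ⟨t₀, ht₀, rfl⟩, ⟨t₁, ht₁, rfl⟩⟩ := hO x hxO y hyO
  -- Near t₀ the curve avoids the relatively closed set `A₁`, so it runs in `A₂`, and then it must
  -- reach y inside `A₂`.
  refine hy (h₂.mapsTo_of_eventually hUc hh (hmaps.mono_right hA.1) ht₀ ?_ ht₁)
  have hcl : h t₀ ∉ closure A₁ := fun hc => hx (h₁.mem_of_mem_closure (hA.1 (hmaps ht₀)) hc)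
  filter_upwards [hUo.mem_nhds ht₀, (hh t₀ ht₀).continuousAt.eventually
    (isClosed_closure.isOpen_compl.mem_nhds hcl)] with t ht ht'
  have := hmaps ht
  rw [hU] at this
  exact this.resolve_left fun hc => ht' (subset_closure hc)

theorem IsRegularPoint.eventually {d : ℕ} {a : E} (h : IsRegularPoint A d a) :
    ∀ᶠ b in 𝓝 a, b ∈ A → IsRegularPoint A d b := by
  obtain ⟨-, e, L, ha, h1, h2, h3, h4⟩ := h
  filter_upwards [e.open_source.mem_nhds ha] with b hb hbA
  exact ⟨hbA, e, L, hb, h1, h2, h3, h4⟩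

variable [FiniteDimensional ℂ E]

/-- The derivative of the transition map e' ∘ e⁻¹ is injective and carries `L` into `L'`, being a
limit of difference quotients along lines in `L`. -/
theorem IsRegularPoint.dim_le {d d' : ℕ} {a : E} (h : IsRegularPoint A d a)
    (h' : IsRegularPoint A d' a) : d ≤ d' := by
  obtain ⟨haA, e, L, ha, h1, h2, rfl, h4⟩ := h
  obtain ⟨-, e', L', ha', h1', h2', rfl, h4'⟩ := h'
  have hat : e a ∈ e.target := e.map_source ha
  have hs : HasFDerivAt e.symm (fderiv ℂ e.symm (e a)) (e a) :=
    (h2 _ hat).differentiableAt.hasFDerivAt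
  have hs' : HasFDerivAt e' (fderiv ℂ e' a) (e.symm (e a)) := by
    rw [e.left_inv ha]; exact (h1' _ ha').differentiableAt.hasFDerivAt
  have hr : HasFDerivAt e (fderiv ℂ e a) (e'.symm (e' a)) := by
    rw [e'.left_inv ha']; exact (h1 _ ha).differentiableAt.hasFDerivAt
  have hr' : HasFDerivAt e'.symm (fderiv ℂ e'.symm (e' a)) (e' a) :=
    (h2' _ (e'.map_source ha')).differentiableAt.hasFDerivAt
  have hD := hs'.comp (e a) hs
  have hD' := hr.comp (e' a) hr'
  set D := (fderiv ℂ e' a).comp (fderiv ℂ e.symm (e a)) with hDdef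
  set D' := (fderiv ℂ e a).comp (fderiv ℂ e'.symm (e' a))
  have hcont : ∀ᶠ y in 𝓝 (e a), e.symm y ∈ e'.source := by
    refine (e.continuousAt_symm hat).eventually (e'.open_source.mem_nhds ?_)
    rwa [e.left_inv ha]
  have hinv : D'.comp D = ContinuousLinearMap.id ℂ E := by
    have hD'' : HasFDerivAt (e ∘ e'.symm) D' ((e' ∘ e.symm) (e a)) := by
      simpa [e.left_inv ha] using hD'
    refine (hD''.comp (e a) hD).unique ((hasFDerivAt_id (e a)).congr_of_eventuallyEq ?_)
    filter_upwards [hcont, e.open_target.mem_nhds hat] with y hy hyt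
    simp [e'.left_inv hy, e.right_inv hyt]
  have hinj : Function.Injective D := fun x y hxy => by
    have := congrArg D' hxy
    rwa [← ContinuousLinearMap.comp_apply, ← ContinuousLinearMap.comp_apply, hinv] at this
  have hmap : ∀ v ∈ L, D v ∈ L' := by
    intro v hv
    have heaL : e a ∈ L := by
      have : a ∈ A ∩ e.source := ⟨haA, ha⟩
      rw [h4] at this
      exact this.2
    have hline : HasDerivAt (fun t : ℂ => e a + t • v) v 0 := by
      simpa using ((hasDerivAt_id (0 : ℂ)).smul_const v).const_add (e a)
    have hD0 : HasFDerivAt (e' ∘ e.symm) D (e a + (0 : ℂ) • v) := by simpa using hD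
    have hder := hD0.comp_hasDerivAt (0 : ℂ) hline
    have hc0 : ∀ᶠ t in 𝓝 (0 : ℂ), e a + t • v ∈ e.target ∧ e.symm (e a + t • v) ∈ e'.source := by
      have : Tendsto (fun t : ℂ => e a + t • v) (𝓝 0) (𝓝 (e a)) := by
        simpa using hline.continuousAt.tendsto
      exact (this.eventually_mem (e.open_target.mem_nhds hat)).and (this.eventually hcont)
    have hL : ∀ᶠ t in 𝓝 (0 : ℂ), e' (e.symm (e a + t • v)) ∈ L' := by
      filter_upwards [hc0] with t ht
      have h5 : e.symm (e a + t • v) ∈ A ∩ e.source := by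
        rw [h4]
        refine ⟨e.map_target ht.1, ?_⟩
        rw [e.right_inv ht.1]
        exact L.add_mem heaL (L.smul_mem _ hv)
      have h6 : e.symm (e a + t • v) ∈ A ∩ e'.source := ⟨h5.1, ht.2⟩
      rw [h4'] at h6
      exact h6.2
    have hcl : IsClosed (L' : Set E) := L'.closed_of_finiteDimensional
    refine hcl.mem_of_tendsto (hasDerivAt_iff_tendsto_slope_zero.1 hder) ?_
    filter_upwards [hL.filter_mono nhdsWithin_le_nhds] with t ht
    refine L'.smul_mem _ (L'.sub_mem (by simpa using ht) ?_)
    simpa using hL.self_of_nhds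
  exact LinearMap.finrank_le_finrank_of_injective
    (f := (D : E →ₗ[ℂ] E).restrict hmap) fun x y hxy => Subtype.ext (hinj (by
      simpa using congrArg Subtype.val hxy))

/-- If the regular points of dimension `d` are dense in `A`, then `A` has dimension `d` at each of
its points. -/
theorem dimAt_eq_of_subset_closure {d : ℕ} (hA : A ⊆ closure {b | IsRegularPoint A d b}) {a : E}
    (ha : a ∈ A) : dimAt A a = d := by
  have huniq : ∀ b d', IsRegularPoint A d' b → d' = d := by
    intro b d' hb
    obtain ⟨c, hc, hc'⟩ := ((mem_closure_iff_frequently.1 (hA hb.1)).and_eventually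
      hb.eventually).exists
    exact ((hc' hc.1).dim_le hc).antisymm (hc.dim_le (hc' hc.1))
  refine le_antisymm ?_ ?_
  · refine (iInf₂_le Set.univ Filter.univ_mem).trans ?_
    refine iSup_le fun b => iSup_le fun _ => iSup_le fun d' => iSup_le fun hd' => ?_
    rw [huniq b d' hd']
  · refine le_iInf₂ fun U hU => ?_
    obtain ⟨b, hb, hbU⟩ := ((mem_closure_iff_frequently.1 (hA ha)).and_eventually hU).exists
    exact le_iSup_of_le b (le_iSup_of_le hbU (le_iSup_of_le d (le_iSup_of_le hb le_rfl)))

/-- A holomorphic level set is regular at the points where the map is a submersion. -/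
theorem isRegularPoint_levelSet {F : Type*} [NormedAddCommGroup F] [NormedSpace ℂ F]
    [FiniteDimensional ℂ F] {f : E → F} (hf : AnalyticOnNhd ℂ f Set.univ) (a : E)
    (S : F →L[ℂ] E) (hS : ∀ w, fderiv ℂ f a (S w) = w) :
    IsRegularPoint {x | f x = f a} (Module.finrank ℂ E - Module.finrank ℂ F) a := by
  have : CompleteSpace E := FiniteDimensional.complete ℂ E
  set f' := fderiv ℂ f a
  -- This φ has derivative the identity at a and satisfies f' ∘ φ = f - f a, so it straightens the
  -- level set to the kernel of f'.
  set φ : E → E := fun x => x + S (f x - f a - f' x) with hφ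
  have hφan : AnalyticOnNhd ℂ φ Set.univ := fun x _ =>
    analyticAt_id.add ((S.analyticAt _).comp
      (((hf x trivial).sub analyticAt_const).sub (f'.analyticAt x)))
  have hφ' : HasStrictFDerivAt φ ((ContinuousLinearEquiv.refl ℂ E : E ≃L[ℂ] E) : E →L[ℂ] E) a := by
    have h1 : HasStrictFDerivAt f f' a := (hf a trivial).hasStrictFDerivAt
    have h2 := (hasStrictFDerivAt_id (𝕜 := ℂ) a).add
      ((S.hasStrictFDerivAt (x := f a - f a - f' a)).comp a
        ((h1.sub_const (f a)).sub f'.hasStrictFDerivAt))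
    refine h2.congr_fderiv ?_
    ext v; simp
  set e₀ := hφ'.toOpenPartialHomeomorph φ
  have hcoe : (e₀ : E → E) = φ := hφ'.toOpenPartialHomeomorph_coe
  have ha₀ : a ∈ e₀.source := hφ'.mem_toOpenPartialHomeomorph_source
  have hsymm : AnalyticAt ℂ e₀.symm (e₀ a) := by
    refine e₀.analyticAt_symm' (i := ContinuousLinearEquiv.refl ℂ E) ha₀ ?_ ?_
    · rw [hcoe]; exact hφan a trivial
    · rw [hcoe]; exact hφ'.hasFDerivAt.fderiv
  obtain ⟨V, hVsub, hV, haV⟩ := eventually_nhds_iff.1 hsymm.eventually_analyticAt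
  set e := (e₀.symm.restrOpen V hV).symm with he
  have hker : ∀ x, f' (φ x) = f x - f a := fun x => by simp [hφ, hS]
  refine ⟨rfl, e, f'.ker, ?_, ?_, ?_, ?_, ?_⟩
  · simp [he, ha₀, haV]
  · intro x hx
    have : (e : E → E) = φ := by rw [← hcoe]; rfl
    rw [this]
    exact hφan x trivial
  · intro y hy
    exact hVsub y (by simpa [he] using hy.2)
  · have hsurj : f'.range = ⊤ := LinearMap.range_eq_top.2 fun w => ⟨S w, hS w⟩
    have := LinearMap.finrank_range_add_finrank_ker (f' : E →ₗ[ℂ] F)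
    rw [hsurj, finrank_top] at this
    omega
  · ext x
    have : e x = φ x := by rw [← hcoe]; rfl
    simp only [Set.mem_inter_iff, Set.mem_ofPred_eq, LinearMap.mem_ker, this]
    rw [and_comm]
    refine and_congr_right fun _ => ?_
    have := hker x
    rw [← sub_eq_zero, ← this]
    rfl

end AnalyticSets

/-! ### The spectral ball and the map σ -/

open Matrix Polynomial

variable {n : ℕ}

/-- By Gelfand's formula some ‖A ^ k‖ ^ (1 / k) is below 1. This quantity is continuous in A and
bounds the spectral radius from above. -/
theorem isOpen_spectralBall (n : ℕ) [NeZero n] : IsOpen (spectralBall n) := by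
  rw [isOpen_iff_mem_nhds]
  intro A hA
  obtain ⟨k, hk, hk0⟩ := (((spectrum.pow_nnnorm_pow_one_div_tendsto_nhds_spectralRadius A).eventually
    (gt_mem_nhds hA)).and (eventually_gt_atTop 0)).exists
  have hcont : Continuous fun B : Matrix (Fin n) (Fin n) ℂ => (‖B ^ k‖₊ : ENNReal) ^ (1 / k : ℝ) :=
    (ENNReal.continuous_rpow_const).comp
      (ENNReal.continuous_coe.comp (continuous_nnnorm.comp (continuous_pow k)))
  filter_upwards [hcont.continuousAt.eventually (gt_mem_nhds hk)] with B hB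
  have h := spectrum.spectralRadius_le_pow_nnnorm_pow_one_div ℂ B (k - 1)
  have hk' : ((k - 1 : ℕ) : ℝ) + 1 = k := by exact_mod_cast Nat.sub_add_cancel hk0
  rw [Nat.sub_add_cancel hk0, hk', nnnorm_one, ENNReal.coe_one, ENNReal.one_rpow, mul_one] at h
  exact h.trans_lt hB

theorem sigma_eq_iff {A B : Matrix (Fin n) (Fin n) ℂ} :
    sigma n A = sigma n B ↔ A.charpoly = B.charpoly := by
  refine ⟨fun h => ?_, fun h => by unfold sigma; rw [h]⟩
  ext k
  rcases lt_trichotomy k n with hk | rfl | hk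
  · have := congrFun h ⟨n - k - 1, by omega⟩
    unfold sigma at this
    have h2 := mul_left_cancel₀ (pow_ne_zero _ (by norm_num)) this
    rwa [show n - (n - k - 1 + 1) = k by omega] at h2
  · have hA := A.charpoly_monic.coeff_natDegree
    have hB := B.charpoly_monic.coeff_natDegree
    simp only [charpoly_natDegree_eq_dim, Fintype.card_fin] at hA hB
    rw [hA, hB]
  · rw [coeff_eq_zero_of_natDegree_lt, coeff_eq_zero_of_natDegree_lt] <;> simpa using hk

theorem mem_spectralBall_of_charpoly_eq {A B : Matrix (Fin n) (Fin n) ℂ}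
    (h : A.charpoly = B.charpoly) (hA : A ∈ spectralBall n) : B ∈ spectralBall n := by
  have hs : spectrum ℂ A = spectrum ℂ B := by
    ext r; rw [mem_spectrum_iff_isRoot_charpoly, mem_spectrum_iff_isRoot_charpoly, h]
  simpa only [spectralBall, Set.mem_ofPred_eq, spectralRadius, hs] using hA

/-- The spectrum depends only on the characteristic polynomial, so the constraint of lying in the
ball is automatic on the level set. -/
theorem fibre_eq {A : Matrix (Fin n) (Fin n) ℂ} (hA : A ∈ spectralBall n) :
    fibre n (sigma n A) = {X | sigma n X = sigma n A} :=
  Set.ext fun _ => ⟨fun h => h.2, fun h =>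
    ⟨mem_spectralBall_of_charpoly_eq (sigma_eq_iff.1 h.symm) hA, h⟩⟩

theorem analyticOnNhd_charpoly_coeff (k : ℕ) :
    AnalyticOnNhd ℂ (fun A : Matrix (Fin n) (Fin n) ℂ => A.charpoly.coeff k) Set.univ := by
  have : (fun A : Matrix (Fin n) (Fin n) ℂ => A.charpoly.coeff k) = fun A =>
      MvPolynomial.aeval (fun ij : Fin n × Fin n => A ij.1 ij.2)
        ((charpoly.univ ℂ (Fin n)).coeff k) := by
    ext A
    have := charpoly.univ_coeff_eval₂Hom (Fin n) (RingHom.id ℂ) (fun ij => A ij.1 ij.2) k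
    rw [MvPolynomial.aeval_eq_eval₂Hom]
    exact this.symm
  rw [this]
  refine AnalyticOnNhd.aeval_mvPolynomial (fun ij => ?_) _
  exact fun A _ => (LinearMap.toContinuousLinearMap
    (Matrix.entryLinearMap ℂ ℂ ij.1 ij.2)).analyticAt A

theorem analyticOnNhd_sigma (n : ℕ) : AnalyticOnNhd ℂ (sigma n) Set.univ := fun A hA =>
  AnalyticAt.pi fun _ => analyticAt_const.mul (analyticOnNhd_charpoly_coeff _ A hA)

theorem sigma_conj {g A : Matrix (Fin n) (Fin n) ℂ} (hg : g.det ≠ 0) :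
    sigma n (g⁻¹ * A * g) = sigma n A := by
  rw [sigma_eq_iff, charpoly_mul_comm, ← mul_assoc, mul_nonsing_inv _ (Ne.isUnit hg), one_mul]

theorem isAnalyticSubset_fibre (n : ℕ) [NeZero n] (z : Fin n → ℂ) :
    IsAnalyticSubset (spectralBall n) (fibre n z) := by
  refine ⟨fun _ h => h.1, fun A hA => ⟨_, isOpen_spectralBall n, hA, subset_rfl, n,
    fun i X => sigma n X i - z i, fun i X _ => ?_, ?_⟩⟩
  · exact (analyticAt_const.mul (analyticOnNhd_charpoly_coeff _ X trivial)).sub analyticAt_const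
  · ext X
    simp only [fibre, Set.mem_inter_iff, Set.mem_ofPred_eq, sub_eq_zero, ← funext_iff]
    tauto

/-! ### Companion matrices, Krylov matrices and conjugation -/

section Companion

/-- The matrix whose last row is minus the list of the lower coefficients of
`λ ^ n + ∑ j, (-1) ^ j w_j λ ^ (n - j)`, with zeros elsewhere, as a linear function of `w`. -/
def lastRow (n : ℕ) : (Fin n → ℂ) →ₗ[ℂ] Matrix (Fin n) (Fin n) ℂ where
  toFun w := of fun i j =>
    if (i : ℕ) + 1 = n then -((-1) ^ (n - (j : ℕ)) * w (Fin.rev j)) else 0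
  map_add' v w := by ext i j; simp only [of_apply, Matrix.add_apply, Pi.add_apply]; split_ifs <;> ring
  map_smul' c w := by
    ext i j; simp only [of_apply, Matrix.smul_apply, Pi.smul_apply, smul_eq_mul, RingHom.id_apply]
    split_ifs <;> ring

/-- The matrix with ones on the superdiagonal and zeros elsewhere. -/
def superdiag (n : ℕ) : Matrix (Fin n) (Fin n) ℂ :=
  of fun i j => if (i : ℕ) + 1 = j then 1 else 0

/-- The companion matrix of `λ ^ n + ∑ j, (-1) ^ j w_j λ ^ (n - j)`. -/
def companion (w : Fin n → ℂ) : Matrix (Fin n) (Fin n) ℂ :=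
  superdiag n + lastRow n w

theorem coeff_charpoly_eq_sigma (A : Matrix (Fin n) (Fin n) ℂ) (j : Fin n) :
    A.charpoly.coeff j = (-1) ^ (n - (j : ℕ)) * sigma n A (Fin.rev j) := by
  have hj := j.2
  simp only [sigma, Fin.val_rev]
  rw [show n - (n - ((j : ℕ) + 1) + 1) = j by omega, show n - ((j : ℕ) + 1) + 1 = n - j by omega,
    ← mul_assoc, ← pow_add, Even.neg_one_pow ⟨_, rfl⟩, one_mul]

theorem pow_eq_sum_sigma (A : Matrix (Fin n) (Fin n) ℂ) :
    A ^ n = ∑ j : Fin n, (-((-1) ^ (n - (j : ℕ)) * sigma n A (Fin.rev j))) • A ^ (j : ℕ) := by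
  have h := aeval_self_charpoly A
  have hm := A.charpoly_monic.coeff_natDegree
  rw [aeval_eq_sum_range, Finset.sum_range_succ, hm, charpoly_natDegree_eq_dim, Fintype.card_fin,
    one_smul, Finset.sum_range] at h
  rw [eq_neg_of_add_eq_zero_right h, ← Finset.sum_neg_distrib]
  refine Finset.sum_congr rfl fun j _ => ?_
  rw [neg_smul, coeff_charpoly_eq_sigma]

theorem superdiag_mul_apply_of_lt (B : Matrix (Fin n) (Fin n) ℂ) {i : Fin n} (hi : (i : ℕ) + 1 < n)
    (j : Fin n) : (superdiag n * B) i j = B ⟨i + 1, hi⟩ j := by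
  rw [mul_apply, Finset.sum_eq_single ⟨i + 1, hi⟩]
  · simp [superdiag]
  · intro k _ hk
    have : (i : ℕ) + 1 ≠ k := fun h => hk (Fin.ext h.symm)
    simp [superdiag, this]
  · simp

theorem superdiag_apply_of_eq {i : Fin n} (hi : (i : ℕ) + 1 = n)
    (j : Fin n) : superdiag n i j = 0 := by
  simp [superdiag, hi, j.2.ne']

variable [NeZero n]

/-- The matrix with rows `e₀, e₀ A, e₀ A², …`; it is invertible iff `e₀` is a cyclic row vector. -/
def krylov (A : Matrix (Fin n) (Fin n) ℂ) : Matrix (Fin n) (Fin n) ℂ :=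
  of fun k j => (A ^ (k : ℕ)) 0 j

/-- Right multiplication by A shifts the rows e₀ Aᵏ by one; Cayley–Hamilton rewrites the last one,
e₀ Aⁿ. -/
theorem krylov_mul (A : Matrix (Fin n) (Fin n) ℂ) :
    krylov A * A = companion (sigma n A) * krylov A := by
  have h1 : ∀ i j, (krylov A * A) i j = (A ^ ((i : ℕ) + 1)) 0 j := by
    intro i j; rw [pow_succ, mul_apply, mul_apply]; rfl
  ext i j
  rw [h1, companion, Matrix.add_mul, Matrix.add_apply]
  by_cases hi : (i : ℕ) + 1 = n
  · rw [mul_apply, mul_apply, Finset.sum_eq_zero (by simp [superdiag_apply_of_eq hi]), hi,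
      pow_eq_sum_sigma, zero_add, Matrix.sum_apply]
    simp [lastRow, hi, krylov]
  · rw [superdiag_mul_apply_of_lt _ (by omega), mul_apply]
    simp [lastRow, hi, krylov]

theorem krylov_companion (w : Fin n → ℂ) : krylov (companion w) = 1 := by
  have : ∀ k (hk : k < n) j, (companion w ^ k) 0 j = (1 : Matrix (Fin n) (Fin n) ℂ) ⟨k, hk⟩ j := by
    intro k
    induction k with
    | zero => intro _ j; simp; rfl
    | succ k ih =>
      intro hk j
      rw [pow_succ, mul_apply, Finset.sum_congr rfl fun l _ => by rw [ih (by omega) l],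
        ← mul_apply, one_mul]
      have : k + 1 ≠ n := by omega
      simp [companion, superdiag, lastRow, this, one_apply, Fin.ext_iff]
  ext k j
  exact this k k.2 j

/-- As the Krylov matrix is 1, `krylov_mul` says that the companion matrices of w and of
σ(`companion w`) agree; their last rows give w back. -/
theorem sigma_companion (w : Fin n → ℂ) : sigma n (companion w) = w := by
  have h := krylov_mul (companion w)
  rw [krylov_companion, one_mul, mul_one] at h
  have h' : lastRow n w = lastRow n (sigma n (companion w)) := add_left_cancel h
  ext j
  have hn := NeZero.pos n
  have h2 := congrFun (congrFun h' ⟨n - 1, by omega⟩) (Fin.rev j)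
  simp only [lastRow, LinearMap.coe_mk, AddHom.coe_mk, of_apply,
    show n - 1 + 1 = n by omega, if_true, neg_inj, Fin.rev_rev] at h2
  exact (mul_left_cancel₀ (pow_ne_zero _ (by norm_num)) h2).symm

theorem eq_conj_companion {A : Matrix (Fin n) (Fin n) ℂ} (hA : (krylov A).det ≠ 0) :
    A = (krylov A)⁻¹ * companion (sigma n A) * krylov A := by
  rw [mul_assoc, ← krylov_mul, ← mul_assoc, nonsing_inv_mul _ (Ne.isUnit hA), one_mul]

theorem isRegularPoint_conj_companion {g : Matrix (Fin n) (Fin n) ℂ} (hg : g.det ≠ 0)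
    (z : Fin n → ℂ) :
    IsRegularPoint {X | sigma n X = z} (n * n - n) (g⁻¹ * companion z * g) := by
  set S : (Fin n → ℂ) →L[ℂ] Matrix (Fin n) (Fin n) ℂ := LinearMap.toContinuousLinearMap
    (LinearMap.mulLeft ℂ g⁻¹ ∘ₗ LinearMap.mulRight ℂ g ∘ₗ lastRow n) with hS
  have hz : ∀ w, sigma n (g⁻¹ * companion w * g) = w := fun w => by
    rw [sigma_conj hg, sigma_companion]
  have haff : ∀ w, g⁻¹ * companion w * g = g⁻¹ * superdiag n * g + S w := fun w => by
    simp [hS, companion, Matrix.mul_add, Matrix.add_mul, mul_assoc]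
  have hder : HasFDerivAt (fun w => g⁻¹ * companion w * g) S z := by
    simp_rw [haff]
    exact S.hasFDerivAt.const_add _
  have hc := ((analyticOnNhd_sigma n _ trivial).differentiableAt.hasFDerivAt
    (x := g⁻¹ * companion z * g)).comp z hder
  -- Differentiating the section identity `hz` shows that `S` is a right inverse of the derivative
  -- of σ.
  have hid := hc.unique ((hasFDerivAt_id z).congr_of_eventuallyEq (Eventually.of_forall hz))
  have := isRegularPoint_levelSet (analyticOnNhd_sigma n) (g⁻¹ * companion z * g) S
    fun w => DFunLike.congr_fun hid w
  simpa [hz, Module.finrank_matrix] using this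

/-- The pencil `A + X B` as a matrix of polynomials. -/
noncomputable def polynomialPencil (A B : Matrix (Fin n) (Fin n) ℂ) : Matrix (Fin n) (Fin n) ℂ[X] :=
  A.map C + (X : ℂ[X]) • B.map C

omit [NeZero n] in
theorem mapMatrix_polynomialPencil (A B : Matrix (Fin n) (Fin n) ℂ) (t : ℂ) :
    (evalRingHom t).mapMatrix (polynomialPencil A B) = A + t • B := by
  ext i j; simp [polynomialPencil, mul_comm (B i j)]

theorem finite_setOf_eval_eq_zero {p : ℂ[X]} {t : ℂ} (h : p.eval t ≠ 0) :
    {t | p.eval t = 0}.Finite :=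
  p.finite_setOfPred_isRoot fun hp => h (by simp [hp])

omit [NeZero n] in
theorem finite_setOf_det_pencil_eq_zero {A B : Matrix (Fin n) (Fin n) ℂ} {t : ℂ}
    (h : (A + t • B).det ≠ 0) : {t : ℂ | (A + t • B).det = 0}.Finite := by
  have key : ∀ t, (A + t • B).det = (polynomialPencil A B).det.eval t := fun t => by
    rw [← mapMatrix_polynomialPencil, ← RingHom.map_det]; rfl
  simp_rw [key] at h ⊢
  exact finite_setOf_eval_eq_zero h

theorem finite_setOf_det_krylov_pencil_eq_zero {A B : Matrix (Fin n) (Fin n) ℂ} {t : ℂ}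
    (h : (krylov (A + t • B)).det ≠ 0) : {t : ℂ | (krylov (A + t • B)).det = 0}.Finite := by
  have key : ∀ t, (krylov (A + t • B)).det = (of fun k j : Fin n =>
      (polynomialPencil A B ^ (k : ℕ)) 0 j).det.eval t := fun t => by
    rw [← coe_evalRingHom, RingHom.map_det]
    congr 1
    ext k j
    simp only [krylov, of_apply, ← mapMatrix_polynomialPencil, ← map_pow]
    rfl
  simp_rw [key] at h ⊢
  exact finite_setOf_eval_eq_zero h

/-- Any two conjugates of the companion matrix lie on an analytic curve of conjugates. -/
theorem exists_analytic_curve_conj_companion {z : Fin n → ℂ} {g₀ g₁ : Matrix (Fin n) (Fin n) ℂ} (h₀ : g₀.det ≠ 0)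
    (h₁ : g₁.det ≠ 0) : ∃ (U : Set ℂ) (h : ℂ → Matrix (Fin n) (Fin n) ℂ), IsOpen U ∧
      IsPreconnected U ∧ AnalyticOnNhd ℂ h U ∧ Set.MapsTo h U {X | sigma n X = z} ∧
      g₀⁻¹ * companion z * g₀ ∈ h '' U ∧ g₁⁻¹ * companion z * g₁ ∈ h '' U := by
  set g : ℂ → Matrix (Fin n) (Fin n) ℂ := fun t => g₀ + t • (g₁ - g₀) with hg
  have hgan : AnalyticOnNhd ℂ g Set.univ := fun t _ =>
    analyticAt_const.add (analyticAt_id.smul analyticAt_const)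
  have hfin : {t | (g t).det = 0}.Finite :=
    finite_setOf_det_pencil_eq_zero (t := 0) (by simpa using h₀)
  refine ⟨{t | (g t).det ≠ 0}, fun t => (g t)⁻¹ * companion z * g t, ?_, ?_, ?_, ?_, ?_, ?_⟩
  · exact hfin.isClosed.isOpen_compl
  -- ℂ has real dimension 2, so removing a countable set leaves it connected.
  · exact (hfin.countable.isConnected_compl_of_one_lt_rank (by simp)).isPreconnected
  · intro t ht
    have hinv : AnalyticAt ℂ (fun t => (g t)⁻¹) t := by
      simp_rw [nonsing_inv_eq_ringInverse]
      have hu : IsUnit (g t) := (isUnit_iff_isUnit_det _).2 (Ne.isUnit ht)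
      exact (analyticAt_inverse hu.unit).comp_of_eq (hgan t trivial) rfl
    exact (hinv.mul analyticAt_const).mul (hgan t trivial)
  · intro t ht
    change sigma n _ = z
    rw [sigma_conj ht, sigma_companion]
  · exact ⟨0, by simpa [hg] using h₀, by simp [hg]⟩
  · exact ⟨1, by simpa [hg] using h₁, by simp [hg]⟩

end Companion

/-! ### Triangularization and density of the conjugates -/

theorem exists_linearIndependent_triangular {V : Type*} [AddCommGroup V] [Module ℂ V]
    [FiniteDimensional ℂ V] (f : Module.End ℂ V) (k : ℕ) (hk : k ≤ Module.finrank ℂ V) :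
    ∃ v : Fin k → V, LinearIndependent ℂ v ∧
      ∀ i, f (v i) ∈ Submodule.span ℂ (v '' Set.Iic i) := by
  induction k with
  | zero => exact ⟨Fin.elim0, linearIndependent_empty_type, fun i => i.elim0⟩
  | succ k ih =>
    obtain ⟨v, hv, hf⟩ := ih (by omega)
    set W := Submodule.span ℂ (Set.range v) with hW
    have hWf : W ≤ W.comap f := by
      rw [hW, Submodule.span_le]
      rintro _ ⟨i, rfl⟩
      exact Submodule.span_mono (Set.image_subset_range _ _) (hf i)
    have hWtop : W ≠ ⊤ := by
      intro h
      have := finrank_span_eq_card hv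
      rw [← hW, h, finrank_top, Fintype.card_fin] at this
      omega
    have : Nontrivial (V ⧸ W) := Submodule.Quotient.nontrivial_iff.2 hWtop
    -- The next vector is a lift of an eigenvector of the operator induced on the quotient by the
    -- invariant subspace `W`.
    obtain ⟨μ, hμ⟩ := Module.End.exists_eigenvalue (W.mapQ W f hWf)
    obtain ⟨q, hq⟩ := hμ.exists_hasEigenvector
    obtain ⟨u, rfl⟩ := W.mkQ_surjective q
    have hu : u ∉ W := fun h => hq.2 (by simpa using h)
    have hfu : f u - μ • u ∈ W := by
      have := hq.apply_eq_smul
      simpa [← Submodule.Quotient.mk_smul, Submodule.Quotient.eq] using this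
    have hIic : ∀ i : Fin k, (Fin.snoc v u : Fin (k + 1) → V) '' Set.Iic i.castSucc ⊇ v '' Set.Iic i := by
      rintro i _ ⟨j, hj, rfl⟩
      exact ⟨j.castSucc, by simpa using hj, by simp⟩
    refine ⟨Fin.snoc v u, linearIndependent_finSnoc.2 ⟨hv, hu⟩, fun i => ?_⟩
    refine Fin.lastCases ?_ (fun i => ?_) i
    · have hle : W ≤ Submodule.span ℂ
          ((Fin.snoc v u : Fin (k + 1) → V) '' Set.Iic (Fin.last k)) := by
        refine Submodule.span_mono ?_
        rintro _ ⟨j, rfl⟩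
        exact ⟨j.castSucc, Fin.le_last _, by simp⟩
      rw [Fin.snoc_last, ← sub_add_cancel (f u) (μ • u)]
      exact Submodule.add_mem _ (hle hfu) (Submodule.smul_mem _ _
        (Submodule.subset_span ⟨Fin.last k, Set.self_mem_Iic, by simp⟩))
    · rw [Fin.snoc_castSucc]
      exact Submodule.span_mono (hIic i) (hf i)

variable {n : ℕ}

theorem exists_conj_isUpperTriangular (A : Matrix (Fin n) (Fin n) ℂ) :
    ∃ P T : Matrix (Fin n) (Fin n) ℂ, P.det ≠ 0 ∧ T.IsUpperTriangular ∧ A = P⁻¹ * T * P := by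
  obtain ⟨v, hv, hf⟩ := exists_linearIndependent_triangular (toLin' A) n (by simp)
  set b := basisOfLinearIndependentOfCardEqFinrank' v hv (by simp) with hb
  have hbv : ⇑b = v := coe_basisOfLinearIndependentOfCardEqFinrank' v hv (by simp)
  set s := Pi.basisFun ℂ (Fin n)
  have h1 : s.toMatrix b * b.toMatrix s = 1 := s.toMatrix_mul_toMatrix_flip b
  refine ⟨b.toMatrix s, LinearMap.toMatrix b b (toLin' A), ?_, ?_, ?_⟩
  · intro h
    have := congrArg det h1
    rw [det_mul, h, mul_zero, det_one] at this
    exact zero_ne_one this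
  · intro i j hij
    rw [LinearMap.toMatrix_apply]
    have h2 := hf j
    rw [← hbv, b.mem_span_image] at h2
    by_contra hne
    exact absurd (h2 (Finsupp.mem_support_iff.2 hne)) (not_le.2 hij)
  · rw [inv_eq_left_inv h1, basis_toMatrix_mul_linearMap_toMatrix_mul_basis_toMatrix]
    exact (LinearMap.toMatrix'_toLin' A).symm

variable [NeZero n]

/-- Each factor moves the support of e₀ Mᵏ at most one column to the right, with leading entry 1, so
the Krylov matrix is lower unitriangular. -/
theorem det_krylov_diagonal_add_superdiag (d : Fin n → ℂ) :
    (krylov (diagonal d + superdiag n)).det = 1 := by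
  set M := diagonal d + superdiag n with hM
  have key : ∀ (k : ℕ) (j : Fin n), k ≤ j → (M ^ k) 0 j = if k = j then 1 else 0 := by
    intro k
    induction k with
    | zero => intro j _; simp [one_apply, Fin.ext_iff]
    | succ k ih =>
      intro j hj
      have hk : k < n := by omega
      rw [pow_succ, mul_apply, Finset.sum_eq_single ⟨k, hk⟩]
      · have : (⟨k, hk⟩ : Fin n) ≠ j := fun h => by simp [← h] at hj
        rw [ih _ le_rfl]
        simp [hM, superdiag, diagonal_apply_ne _ this]
      · intro l _ hl
        have hl' : (l : ℕ) ≠ k := fun h => hl (Fin.ext h)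
        by_cases hlk : k ≤ l
        · rw [ih l hlk, if_neg hl'.symm, zero_mul]
        · have h1 : l ≠ j := fun h => by rw [h] at hlk; omega
          have h2 : (l : ℕ) + 1 ≠ j := by omega
          simp [hM, superdiag, diagonal_apply_ne _ h1, h2]
      · simp
  have hlow : (krylov M).IsLowerTriangular := by
    intro i j hij
    have hij' : (i : ℕ) < j := hij
    simp only [krylov, of_apply]
    rw [key _ _ hij'.le, if_neg hij'.ne]
  rw [det_of_isLowerTriangular _ hlow]
  exact Finset.prod_eq_one fun i _ => by simp [krylov, key i i le_rfl]

/-- Every matrix is a limit of conjugates of the companion matrix of its characteristic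
polynomial. -/
theorem mem_closure_conj_companion (A : Matrix (Fin n) (Fin n) ℂ) :
    A ∈ closure {B | ∃ g : Matrix (Fin n) (Fin n) ℂ, g.det ≠ 0 ∧
      B = g⁻¹ * companion (sigma n A) * g} := by
  obtain ⟨P, T, hP, hT, hA⟩ := exists_conj_isUpperTriangular A
  -- `T + t • S` has the same diagonal as `T` for all t and at t = 1 is diag(T) plus the
  -- superdiagonal, where the Krylov determinant is 1.
  set S := diagonal T.diag + superdiag n - T with hS
  have hsigma : ∀ t : ℂ, sigma n (T + t • S) = sigma n A := by
    intro t
    have htri : (T + t • S).IsUpperTriangular := by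
      intro i j hij
      have hij' : (j : ℕ) < i := hij
      have h1 : (i : ℕ) + 1 ≠ j := by omega
      have h2 : i ≠ j := ne_of_gt hij
      have h3 : T i j = 0 := hT hij
      simp [hS, h3, superdiag, h1, diagonal_apply_ne _ h2]
    rw [hA, sigma_conj hP, sigma_eq_iff, charpoly_of_isUpperTriangular _ htri,
      charpoly_of_isUpperTriangular _ hT]
    simp [hS, superdiag]
  have hfin : {t : ℂ | (krylov (T + t • S)).det = 0}.Finite := by
    refine finite_setOf_det_krylov_pencil_eq_zero (t := 1) ?_
    rw [hS, one_smul, add_sub_cancel, det_krylov_diagonal_add_superdiag]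
    exact one_ne_zero
  have hlim : Tendsto (fun t : ℂ => P⁻¹ * (T + t • S) * P) (𝓝[≠] 0) (𝓝 A) := by
    have : Continuous fun t : ℂ => P⁻¹ * (T + t • S) * P := by fun_prop
    have h0 := this.tendsto 0
    rw [zero_smul, add_zero, ← hA] at h0
    exact h0.mono_left nhdsWithin_le_nhds
  refine mem_closure_of_tendsto hlim ?_
  have hev : ∀ᶠ t in 𝓝[≠] (0 : ℂ), (krylov (T + t • S)).det ≠ 0 :=
    nhdsNE_le_cofinite 0 hfin.compl_mem_cofinite
  filter_upwards [hev] with t ht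
  refine ⟨krylov (T + t • S) * P, by rw [det_mul]; exact mul_ne_zero ht hP, ?_⟩
  conv_lhs => rw [eq_conj_companion ht, hsigma]
  simp only [Matrix.mul_inv_rev, mul_assoc]

end SpectralBall

theorem corollary7 (n : ℕ) (hn : 2 ≤ n) (z : Fin n → ℂ)
    (hz : z ∈ SpectralBall.symmetrizedPolydisc n) :
    SpectralBall.IsIrreducibleAnalyticSubset (SpectralBall.spectralBall n)
        (SpectralBall.fibre n z) ∧
      SpectralBall.HasCodimension (SpectralBall.fibre n z) n := by
  have : NeZero n := ⟨by omega⟩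
  obtain ⟨A, hA, rfl⟩ := hz
  have hfib := SpectralBall.fibre_eq hA
  constructor
  · refine (SpectralBall.isAnalyticSubset_fibre n _).isIrreducible (O := {B | ∃ g : Matrix (Fin n)
      (Fin n) ℂ, g.det ≠ 0 ∧ B = g⁻¹ * SpectralBall.companion (SpectralBall.sigma n A) * g})
      (fun B hB => ?_) ⟨A, hA, rfl⟩ ?_
    · rw [← hB.2]
      exact SpectralBall.mem_closure_conj_companion B
    · rintro _ ⟨g₀, h₀, rfl⟩ _ ⟨g₁, h₁, rfl⟩
      rw [hfib]
      exact SpectralBall.exists_analytic_curve_conj_companion h₀ h₁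
  · intro B hB
    have hdense : SpectralBall.fibre n (SpectralBall.sigma n A) ⊆ closure
        {B | SpectralBall.IsRegularPoint (SpectralBall.fibre n (SpectralBall.sigma n A))
          (n * n - n) B} := by
      intro X hX
      have hX' := SpectralBall.mem_closure_conj_companion X
      rw [hX.2] at hX'
      refine closure_mono ?_ hX'
      rintro _ ⟨g, hg, rfl⟩
      change SpectralBall.IsRegularPoint _ _ _
      rw [hfib]
      exact SpectralBall.isRegularPoint_conj_companion hg _
    rw [SpectralBall.dimAt_eq_of_subset_closure hdense hB, Module.finrank_matrix]
    have hle : n ≤ n * n := Nat.le_mul_self n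
    simp only [Fintype.card_fin, Module.finrank_self, mul_one]
    exact_mod_cast Nat.sub_add_cancel hle
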